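/- Fix $0<\alpha\le 1$ and $R,h,\delta_0,a>0$. Let $K:\mathbb{R}^2\to\mathbb{C}$ be of class $C^{1,\alpha}$ (it is enough that $K$ is $C^1$ with derivative $\alpha$-Hölder continuous on every ball), with $K(x)\to 0$ as $\|x\|\to\infty$, and let $J(x)=\int_{\mathbb{R}^2}\hat J(\xi)e^{-i\xi\cdot x}\,d\xi$ where $\hat J\in L^1(\mathbb{R}^2)$ and $\hat J\ge 0$ almost everywhere. Let $$A=\{u\in L^1(\mathbb{R}^2): 0\le u\le 1 \text{ a.e. in }\mathbb{R}^2,\ u=0\text{ a.e. outside }B_R\},$$ where $B_\rho$ is the open ball of radius $\rho$ centred at $0$, and, for $u\in A$ and $x\in\mathbb{R}^2$, $$\mathcal I(u)(x)=\int_{\mathbb{R}^2}\int_{\mathbb{R}^2}u(\xi)K(x-\xi)J(\xi-\eta)\overline{K(x-\eta)}\,u(\eta)\,d\xi\,d\eta$$ (which is real), $\Omega(u)=\{x\in\mathbb{R}^2:\mathcal I(u)(x)>h\}$ and $\mathcal W(u)=\chi_{\Omega(u)}$. Let $f:\mathbb{R}\to[0,+\infty]$ be continuous and nonincreasing, with $f=+\infty$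 on $(-\infty,0]$, $f=0$ on $[\delta_0,+\infty)$ and $\liminf_{s\to0^+}f(s)s^{2/\alpha}>0$. Let $\varphi:\mathbb{R}\to\mathbb{R}$ be $C^1$, nondecreasing on $(-\infty,h]$, nonincreasing on $[h,+\infty)$, with $\varphi(h)>0$ and $\varphi(0)<-\delta_0$. For $u\in A$ put $$\mathcal R(u)=\int_{\mathbb{R}^2}f\big(\|\nabla\mathcal I(u)\|^2-\varphi(\mathcal I(u))\big)\in[0,+\infty].$$ For an open set $\mathcal D\subset\mathbb{R}^2$, $BV(\mathcal D)$ is the set of $w\in L^1(\mathcal D)$ whose distributional derivative has finite total variation $|Dw|(\mathcal D)$, and on it $$d_{st}(w,z)=\int_{\mathcal D}|w-z|+a\,\big||Dw|(\mathcal D)-|Dz|(\mathcal D)\big|.$$ Then there is $R_1\ge R$ such that $\Omega(u)\subset B_{R_1}$ for every $u\in A$ with $\mathcal R(u)<+\infty$. Moreover, for every such $R_1$, with $\tilde R=R_1+1$, and for every $C>0$, the map $\mathcal W$ sends $\tilde A_C=\{u\in A:\mathcal R(u)\le C\}$ into $BV(B_{\tilde R})$ and is uniformly continuous with respect to the $L^1$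 norm on $\tilde A_C$ and the distance $d_{st}$ on $BV(B_{\tilde R})$: for every $\varepsilon>0$ there is $\eta>0$ such that, for all $u,v\in\tilde A_C$ with $\|u-v\|_{L^1(\mathbb{R}^2)}<\eta$, one has $d_{st}(\mathcal W(u),\mathcal W(v))<\varepsilon$. -/

import Mathlib

open MeasureTheory Filter Topology
open scoped ENNReal InnerProductSpace

namespace Lithography

noncomputable section

/-- The Euclidean plane. -/
abbrev Plane : Type := EuclideanSpace ℝ (Fin 2)

/-! ### Functions of bounded variation -/

/-- The divergence of a vector field on the plane. -/
def divergence (X : Plane → Plane) (x : Plane) : ℝ :=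
  ∑ i : Fin 2, (fderiv ℝ X x (EuclideanSpace.single i 1)) i

/-- The admissible test fields in the definition of the variation on `D`: compactly supported
`C¹` vector fields in `D` of length at most one. -/
structure IsTestField (D : Set Plane) (X : Plane → Plane) : Prop where
  contDiff : ContDiff ℝ 1 X
  compact_support : HasCompactSupport X
  support_subset : tsupport X ⊆ D
  norm_le_one : ∀ x, ‖X x‖ ≤ 1

/-- The total variation `|Du|(D)` of the distributional derivative of `u` in the open set `D`. -/
def variation (D : Set Plane) (u : Plane → ℝ) : ℝ≥0∞ :=
  ⨆ (X : Plane → Plane) (_ : IsTestField D X),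
    ENNReal.ofReal (∫ x in D, u x * divergence X x)

/-- `u ∈ BV(D)`: `u` is integrable on `D` and its distributional derivative there has finite total
variation. -/
def MemBV (D : Set Plane) (u : Plane → ℝ) : Prop :=
  IntegrableOn u D ∧ variation D u < ∞

/-- The distance of strict convergence on `BV(D)`, with weight `a`:
`∫_D |u - v| + a ||Du|(D) - |Dv|(D)|`. -/
def strictDist (a : ℝ) (D : Set Plane) (u v : Plane → ℝ) : ℝ :=
  (∫ x in D, |u x - v x|) + a * |(variation D u).toReal - (variation D v).toReal|

/-! ### The optical model -/

/-- `K` is continuously differentiable, with derivative `α`-Hölder continuous on every ball. -/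
def IsC1Holder (α : ℝ) (K : Plane → ℂ) : Prop :=
  ContDiff ℝ 1 K ∧
    ∀ ρ : ℝ, ∃ M : ℝ, ∀ x ∈ Metric.ball (0 : Plane) ρ, ∀ y ∈ Metric.ball (0 : Plane) ρ,
      ‖fderiv ℝ K x - fderiv ℝ K y‖ ≤ M * ‖x - y‖ ^ α

/-- The Fourier transform `x ↦ ∫ g(ξ) e^{-i ξ·x} dξ`. -/
def fourier (g : Plane → ℝ) (x : Plane) : ℂ :=
  ∫ ξ : Plane, (g ξ : ℂ) * Complex.exp (-(Complex.I * ((⟪ξ, x⟫_ℝ : ℝ) : ℂ)))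

/-- The set `A` of the `u ∈ L¹(ℝ²)` with `0 ≤ u ≤ 1` almost everywhere and `u = 0` almost
everywhere outside `B_R`. -/
def admissible (R : ℝ) : Set (Lp ℝ 1 (volume : Measure Plane)) :=
  {u | (∀ᵐ x, 0 ≤ u x ∧ u x ≤ 1) ∧ ∀ᵐ x, x ∉ Metric.ball (0 : Plane) R → u x = 0}

/-- The Hopkins intensity `I(u)(x) = ∫∫ u(ξ) K(x-ξ) J(ξ-η) conj(K(x-η)) u(η) dξ dη`. Under the
assumptions on `K` and `J` this double integral is real; taking the real part only serves to view
`I(u)` as a real valued function. -/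
def intensity (K J : Plane → ℂ) (u : Lp ℝ 1 (volume : Measure Plane)) (x : Plane) : ℝ :=
  (∫ η : Plane, ∫ ξ : Plane,
    (u ξ : ℂ) * K (x - ξ) * J (ξ - η) * (starRingEnd ℂ) (K (x - η)) * (u η : ℂ)).re

/-- The exposed region `Ω(u) = {I(u) > h}`. -/
def exposed (K J : Plane → ℂ) (h : ℝ) (u : Lp ℝ 1 (volume : Measure Plane)) : Set Plane :=
  {x | h < intensity K J u x}

/-- The thresholding map `W(u)`, the characteristic function of `Ω(u)`. -/
def threshold (K J : Plane → ℂ) (h : ℝ) (u : Lp ℝ 1 (volume : Measure Plane)) : Plane → ℝ :=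
  (exposed K J h u).indicator 1

/-! ### The regularization term -/

/-- The requirements on the penalty function `f : ℝ → [0, +∞]`. -/
structure IsPenalty (α δ₀ : ℝ) (f : ℝ → ℝ≥0∞) : Prop where
  continuous : Continuous f
  eq_top : ∀ s ≤ 0, f s = ∞
  antitone : Antitone f
  eq_zero : ∀ s, δ₀ ≤ s → f s = 0
  blow_up : 0 < liminf (fun s : ℝ => f s * ENNReal.ofReal (s ^ (2 / α))) (𝓝[>] 0)

/-- The requirements on the auxiliary function `φ : ℝ → ℝ`. -/
structure IsLevelWeight (h δ₀ : ℝ) (φ : ℝ → ℝ) : Prop where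
  contDiff : ContDiff ℝ 1 φ
  pos : 0 < φ h
  monotone_before : MonotoneOn φ (Set.Iic h)
  antitone_after : AntitoneOn φ (Set.Ici h)
  at_zero : φ 0 < -δ₀

/-- The regularization term `R(u) = ∫ f(‖∇ I(u)‖² - φ(I(u)))`. -/
def regularizer (K J : Plane → ℂ) (f : ℝ → ℝ≥0∞) (φ : ℝ → ℝ)
    (u : Lp ℝ 1 (volume : Measure Plane)) : ℝ≥0∞ :=
  ∫⁻ x : Plane, f (‖gradient (intensity K J u) x‖ ^ 2 - φ (intensity K J u x))

/-- The sublevel set `{u ∈ A : R(u) ≤ C}`. -/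
def sublevel (R : ℝ) (K J : Plane → ℂ) (f : ℝ → ℝ≥0∞) (φ : ℝ → ℝ) (C : ℝ) :
    Set (Lp ℝ 1 (volume : Measure Plane)) :=
  {u | u ∈ admissible R ∧ regularizer K J f φ u ≤ ENNReal.ofReal C}

/-- `B_{R₁}` contains the exposed region of every `u ∈ A` with `R(u)` finite. -/
def Encloses (R : ℝ) (K J : Plane → ℂ) (h : ℝ) (f : ℝ → ℝ≥0∞) (φ : ℝ → ℝ) (R₁ : ℝ) : Prop :=
  ∀ u ∈ admissible R, regularizer K J f φ u < ∞ →
    exposed K J h u ⊆ Metric.ball (0 : Plane) R₁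

end

end Lithography

/-! The intensity pairs `u ⊗ u` with a `C¹` kernel, and the masks in `A` live in a fixed ball with
mass at most `|B_R|`. Hence, on bounded sets, `I(u)` and `∇I(u)` are Lipschitz in `u` for the `L¹`
norm and the gradients are equicontinuous uniformly in `u`; since `K` vanishes at infinity, `I(u)`
is uniformly small far away. If `R(u)` is finite, then `‖∇I(u)‖² ≥ φ(I(u))` at every point, so
`‖∇I(u)‖ ≥ m > 0` wherever `|I(u) - h| ≤ t`, with `m` and `t` independent of `u`.

The rest is a calibration argument. Mollifying the outward normal `-∇I(u)/‖∇I(u)‖` at a fixed scale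
gives a test field `X` with `|div X| ≤ L`, `L` independent of `u`, and `-⟨∇I(u), X⟩` close to
`‖∇I(u)‖` (`exists_calibrating_field`). Integrating `div X` against a suitable function of `I(u)`
bounds the area of a level strip by a multiple of its width (`measureReal_strip_le`). The regions
`Ω(u)` and `Ω(v)` differ only inside such a strip, which settles the `L¹` term.

For the perimeters `P`, the field `X` built from `u` still nearly calibrates `Ω(v)` when `v` is
close to `u` (`variation_superlevel_le`, `exists_common_calibration`), so `P(v) ≤ (1 + 2θ) ∫_{Ω(v)}
div X ≤ (1 + 2θ) (∫_{Ω(u)} div X + L |Ω(u) Δ Ω(v)|) ≤ (1 + 2θ) (P(u) + L |Ω(u) Δ Ω(v)|)`. Exchanging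
`u` and `v` gives the continuity of the perimeter. -/

namespace Lithography

/-! ### Integrals against a weight supported in a ball -/

section WeightedIntegral

variable {E P V : Type*} [NormedAddCommGroup P] [MeasurableSpace P] [NormedAddCommGroup V]
  [NormedSpace ℝ V] {μ : Measure P}

theorem norm_integral_smul_le_of_ae_eq_zero {R M : ℝ} {w : P → ℝ}
    (hw : Integrable w μ) (hwR : ∀ᵐ p ∂μ, p ∉ Metric.closedBall (0 : P) R → w p = 0)
    {H : P → V} (hM : ∀ p ∈ Metric.closedBall (0 : P) R, ‖H p‖ ≤ M) :
    ‖∫ p, w p • H p ∂μ‖ ≤ M * ∫ p, ‖w p‖ ∂μ := by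
  rw [mul_comm, ← integral_mul_const]
  refine norm_integral_le_of_norm_le (hw.norm.mul_const M) ?_
  filter_upwards [hwR] with p hp
  rw [norm_smul]
  by_cases h : p ∈ Metric.closedBall (0 : P) R
  · exact mul_le_mul_of_nonneg_left (hM p h) (norm_nonneg _)
  · simp [hp h]

variable [ProperSpace P] [BorelSpace P]

/-- A weight vanishing off a ball makes a continuous function integrable. -/
theorem integrable_smul_of_ae_eq_zero [SecondCountableTopologyEither P V] {R : ℝ} {w : P → ℝ}
    (hw : Integrable w μ) (hwR : ∀ᵐ p ∂μ, p ∉ Metric.closedBall (0 : P) R → w p = 0)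
    {H : P → V} (hH : Continuous H) : Integrable (fun p => w p • H p) μ := by
  obtain ⟨M, hM⟩ := (isCompact_closedBall (0 : P) R).exists_bound_of_continuousOn hH.continuousOn
  refine (hw.norm.mul_const M).mono' (hw.1.smul hH.aestronglyMeasurable) ?_
  filter_upwards [hwR] with p hp
  rw [norm_smul]
  by_cases h : p ∈ Metric.closedBall (0 : P) R
  · exact mul_le_mul_of_nonneg_left (hM p h) (norm_nonneg _)
  · simp [hp h]

theorem norm_integral_smul_sub_le_of_ae_eq_zero [SecondCountableTopologyEither P V] {R M : ℝ}
    {w w' : P → ℝ} (hw : Integrable w μ) (hw' : Integrable w' μ)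
    (hwR : ∀ᵐ p ∂μ, p ∉ Metric.closedBall (0 : P) R → w p = 0)
    (hwR' : ∀ᵐ p ∂μ, p ∉ Metric.closedBall (0 : P) R → w' p = 0)
    {H : P → V} (hH : Continuous H) (hM : ∀ p ∈ Metric.closedBall (0 : P) R, ‖H p‖ ≤ M) :
    ‖(∫ p, w p • H p ∂μ) - ∫ p, w' p • H p ∂μ‖ ≤ M * ∫ p, ‖w p - w' p‖ ∂μ := by
  rw [← integral_sub (integrable_smul_of_ae_eq_zero hw hwR hH)
    (integrable_smul_of_ae_eq_zero hw' hwR' hH)]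
  simp_rw [← sub_smul]
  refine norm_integral_smul_le_of_ae_eq_zero (hw.sub hw') ?_ hM
  filter_upwards [hwR, hwR'] with p h1 h2 hp
  rw [Pi.sub_apply, h1 hp, h2 hp, sub_zero]

variable [NormedAddCommGroup E] [ProperSpace E]

/-- Uniform modulus of continuity of weighted integrals of a jointly continuous function. -/
theorem exists_norm_integral_smul_sub_le [SecondCountableTopologyEither P V] (R ρ : ℝ)
    {H : E → P → V} (hH : Continuous fun z : E × P => H z.1 z.2) {δ B : ℝ} (hδ : 0 < δ)
    (hB : 0 ≤ B) :
    ∃ r > 0, ∀ w : P → ℝ, Integrable w μ →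
      (∀ᵐ p ∂μ, p ∉ Metric.closedBall (0 : P) R → w p = 0) → ∫ p, ‖w p‖ ∂μ ≤ B →
      ∀ x ∈ Metric.closedBall (0 : E) ρ, ∀ y ∈ Metric.closedBall (0 : E) ρ, dist x y < r →
        ‖(∫ p, w p • H x p ∂μ) - ∫ p, w p • H y p ∂μ‖ ≤ δ := by
  have hc := ((isCompact_closedBall (0 : E) ρ).prod
    (isCompact_closedBall (0 : P) R)).uniformContinuousOn_of_continuous hH.continuousOn
  -- The `+ 1` keeps the denominator positive when `B = 0`.
  obtain ⟨r, hr, hrH⟩ := Metric.uniformContinuousOn_iff.1 hc (δ / (B + 1)) (by positivity)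
  have hHx : ∀ x, Continuous (H x) := fun x => hH.comp (Continuous.prodMk_right x)
  refine ⟨r, hr, fun w hw hwR hwB x hx y hy hxy => ?_⟩
  rw [← integral_sub (integrable_smul_of_ae_eq_zero hw hwR (hHx x))
    (integrable_smul_of_ae_eq_zero hw hwR (hHx y))]
  simp_rw [← smul_sub]
  refine (norm_integral_smul_le_of_ae_eq_zero hw hwR (M := δ / (B + 1)) fun p hp => ?_).trans ?_
  · rw [← dist_eq_norm]
    refine (hrH (x, p) ⟨hx, hp⟩ (y, p) ⟨hy, hp⟩ ?_).le
    rw [Prod.dist_eq, dist_self]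
    exact max_lt hxy hr
  · calc δ / (B + 1) * ∫ p, ‖w p‖ ∂μ ≤ δ / (B + 1) * (B + 1) := by gcongr; linarith
      _ = δ := by field_simp

variable [NormedSpace ℝ E]

/-- Differentiation under the integral: `G'` is bounded on the compact product of the unit ball
about `x` and the ball carrying `w`, so a multiple of `‖w‖` dominates. -/
theorem hasFDerivAt_integral_smul_of_ae_eq_zero {R : ℝ} {w : P → ℝ}
    (hw : Integrable w μ) (hwR : ∀ᵐ p ∂μ, p ∉ Metric.closedBall (0 : P) R → w p = 0)
    {G : E → P → ℝ} {G' : E → P → (E →L[ℝ] ℝ)}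
    (hG : Continuous fun z : E × P => G z.1 z.2) (hG' : Continuous fun z : E × P => G' z.1 z.2)
    (hGG' : ∀ x p, HasFDerivAt (G · p) (G' x p) x) (x : E) :
    HasFDerivAt (fun x => ∫ p, w p • G x p ∂μ) (∫ p, w p • G' x p ∂μ) x := by
  have hGx : ∀ x, Continuous (G x) := fun x => hG.comp (Continuous.prodMk_right x)
  have hGx' : ∀ x, Continuous (G' x) := fun x => hG'.comp (Continuous.prodMk_right x)
  obtain ⟨M, hM⟩ := ((isCompact_closedBall x 1).prod
    (isCompact_closedBall (0 : P) R)).exists_bound_of_continuousOn hG'.continuousOn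
  refine hasFDerivAt_integral_of_dominated_of_fderiv_le (𝕜 := ℝ)
    (bound := fun p => ‖w p‖ * M) (Metric.closedBall_mem_nhds x one_pos)
    (Eventually.of_forall fun y => (integrable_smul_of_ae_eq_zero hw hwR (hGx y)).1)
    (integrable_smul_of_ae_eq_zero hw hwR (hGx x))
    (integrable_smul_of_ae_eq_zero hw hwR (hGx' x)).1 ?_ (hw.norm.mul_const M)
    (Eventually.of_forall fun p y _ => (hGG' y p).const_smul (w p))
  filter_upwards [hwR] with p hp y hy
  rw [norm_smul]
  by_cases h : p ∈ Metric.closedBall (0 : P) R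
  · exact mul_le_mul_of_nonneg_left (hM (y, p) ⟨hy, h⟩) (norm_nonneg _)
  · simp [hp h]

end WeightedIntegral

/-! ### Regularity of the intensity and its dependence on the mask -/

section Intensity

/-- The real part of the integrand of the Hopkins intensity, without the mask. -/
noncomputable def kernel (K J : Plane → ℂ) (x : Plane) (p : Plane × Plane) : ℝ :=
  (K (x - p.1) * J (p.1 - p.2) * (starRingEnd ℂ) (K (x - p.2))).re

/-- The derivative of `kernel` in the observation point. -/
noncomputable def kernelDeriv (K J : Plane → ℂ) (x : Plane) (p : Plane × Plane) :
    Plane →L[ℝ] ℝ :=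
  Complex.reCLM.comp
    ((K (x - p.1) * J (p.1 - p.2)) • (Complex.conjCLE : ℂ →L[ℝ] ℂ).comp (fderiv ℝ K (x - p.2)) +
      (starRingEnd ℂ) (K (x - p.2)) • J (p.1 - p.2) • fderiv ℝ K (x - p.1))

/-- The mask on pairs of points. -/
noncomputable def pairMask (u : Lp ℝ 1 (volume : Measure Plane)) (p : Plane × Plane) : ℝ :=
  u p.1 * u p.2

variable {K J : Plane → ℂ}

theorem continuous_kernel (hK : ContDiff ℝ 1 K) (hJ : Continuous J) :
    Continuous fun z : Plane × (Plane × Plane) => kernel K J z.1 z.2 := by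
  have := hK.continuous
  unfold kernel
  fun_prop

theorem continuous_kernelDeriv (hK : ContDiff ℝ 1 K) (hJ : Continuous J) :
    Continuous fun z : Plane × (Plane × Plane) => kernelDeriv K J z.1 z.2 := by
  have h0 := hK.continuous
  have h1 := hK.continuous_fderiv one_ne_zero
  unfold kernelDeriv
  fun_prop

theorem hasFDerivAt_kernel (hK : ContDiff ℝ 1 K) (x : Plane) (p : Plane × Plane) :
    HasFDerivAt (kernel K J · p) (kernelDeriv K J x p) x := by
  have hd : ∀ q : Plane, HasFDerivAt (fun x => K (x - q)) (fderiv ℝ K (x - q)) x := fun q =>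
    ((hK.differentiable one_ne_zero (x - q)).hasFDerivAt).comp x ((hasFDerivAt_id x).sub_const q)
  have h2 := (Complex.conjCLE : ℂ →L[ℝ] ℂ).hasFDerivAt.comp x (hd p.2)
  have h1 := (hd p.1).mul_const (J (p.1 - p.2))
  exact Complex.reCLM.hasFDerivAt.comp x (h1.mul h2)

theorem continuous_fourier {g : Plane → ℝ} (hg : Integrable g) : Continuous (fourier g) := by
  unfold fourier
  refine continuous_of_dominated (bound := fun ξ => ‖g ξ‖) (fun x => ?_) (fun x => ?_) hg.norm ?_
  · refine (Complex.continuous_ofReal.comp_aestronglyMeasurable hg.1).mul ?_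
    exact Continuous.aestronglyMeasurable (by fun_prop)
  · refine Eventually.of_forall fun ξ => ?_
    rw [norm_mul, Complex.norm_exp]
    simp
  · exact Eventually.of_forall fun ξ => by fun_prop

variable {R : ℝ} {u v : Lp ℝ 1 (volume : Measure Plane)}

theorem integrable_pairMask (u : Lp ℝ 1 (volume : Measure Plane)) : Integrable (pairMask u) :=
  (L1.integrable_coeFn u).mul_prod (L1.integrable_coeFn u)

theorem integral_norm_pairMask (u : Lp ℝ 1 (volume : Measure Plane)) :
    ∫ p, ‖pairMask u p‖ = ‖u‖ ^ 2 := by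
  simp_rw [pairMask, norm_mul]
  rw [Measure.volume_eq_prod, integral_prod_mul (fun x => ‖u x‖) fun x => ‖u x‖,
    ← L1.norm_eq_integral_norm, sq]

theorem pairMask_ae_eq_zero (hu : u ∈ admissible R) :
    ∀ᵐ p, p ∉ Metric.closedBall (0 : Plane × Plane) R → pairMask u p = 0 := by
  have h1 := Measure.quasiMeasurePreserving_fst
    (μ := (volume : Measure Plane)) (ν := (volume : Measure Plane)) |>.ae hu.2
  have h2 := Measure.quasiMeasurePreserving_snd
    (μ := (volume : Measure Plane)) (ν := (volume : Measure Plane)) |>.ae hu.2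
  rw [← Measure.volume_eq_prod] at h1 h2
  filter_upwards [h1, h2] with p hp1 hp2 hp
  by_contra hne
  obtain ⟨n1, n2⟩ := mul_ne_zero_iff.1 hne
  have m1 := not_imp_comm.1 hp1 n1
  have m2 := not_imp_comm.1 hp2 n2
  refine hp ?_
  -- The product carries the sup norm, so its ball is the product of the two balls.
  rw [mem_closedBall_zero_iff, Prod.norm_def]
  exact max_le (mem_ball_zero_iff.1 m1).le (mem_ball_zero_iff.1 m2).le

/-- Polarization: `u ⊗ u - v ⊗ v = u ⊗ (u - v) + (u - v) ⊗ v`. -/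
theorem integral_norm_pairMask_sub_le (u v : Lp ℝ 1 (volume : Measure Plane)) :
    ∫ p, ‖pairMask u p - pairMask v p‖ ≤ (‖u‖ + ‖v‖) * ‖u - v‖ := by
  have hi : ∀ f g : Lp ℝ 1 (volume : Measure Plane),
      Integrable (fun p : Plane × Plane => ‖f p.1‖ * ‖g p.2‖) := fun f g =>
    (L1.integrable_coeFn f).norm.mul_prod (L1.integrable_coeFn g).norm
  have hp : ∀ f g : Lp ℝ 1 (volume : Measure Plane),
      ∫ p : Plane × Plane, ‖f p.1‖ * ‖g p.2‖ = ‖f‖ * ‖g‖ := fun f g => by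
    rw [Measure.volume_eq_prod, integral_prod_mul (fun x => ‖f x‖) fun x => ‖g x‖,
      ← L1.norm_eq_integral_norm, ← L1.norm_eq_integral_norm]
  have h0 := Lp.coeFn_sub u v
  have h1 := Measure.quasiMeasurePreserving_fst
    (μ := (volume : Measure Plane)) (ν := (volume : Measure Plane)) |>.ae h0
  have h2 := Measure.quasiMeasurePreserving_snd
    (μ := (volume : Measure Plane)) (ν := (volume : Measure Plane)) |>.ae h0
  rw [← Measure.volume_eq_prod] at h1 h2
  calc ∫ p, ‖pairMask u p - pairMask v p‖
      ≤ ∫ p : Plane × Plane, (‖u p.1‖ * ‖(u - v) p.2‖ + ‖(u - v) p.1‖ * ‖v p.2‖) := by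
        refine integral_mono_ae ((integrable_pairMask u).sub (integrable_pairMask v)).norm
          ((hi _ _).add (hi _ _)) ?_
        filter_upwards [h1, h2] with p hp1 hp2
        simp only [pairMask, hp1, hp2, Pi.sub_apply, ← norm_mul]
        refine le_trans (le_of_eq ?_) (norm_add_le _ _)
        congr 1; ring
    _ = (‖u‖ + ‖v‖) * ‖u - v‖ := by
        rw [integral_add (hi _ _) (hi _ _), hp, hp]; ring

/-- By Fubini the quadratic dependence on `u` becomes linear in `pairMask u`, which brings the
estimates for weighted integrals to bear. -/
theorem intensity_eq_integral (hK : ContDiff ℝ 1 K) (hJ : Continuous J)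
    (hu : u ∈ admissible R) (x : Plane) :
    intensity K J u x = ∫ p, pairMask u p • kernel K J x p := by
  have h0 := hK.continuous
  have hc : Continuous fun p : Plane × Plane =>
      K (x - p.1) * J (p.1 - p.2) * (starRingEnd ℂ) (K (x - p.2)) := by fun_prop
  have hint := integrable_smul_of_ae_eq_zero (integrable_pairMask u) (pairMask_ae_eq_zero hu) hc
  have hre := Complex.reCLM.integral_comp_comm hint
  simp only [Complex.reCLM_apply, Complex.smul_re] at hre
  unfold kernel
  rw [hre, Measure.volume_eq_prod, integral_prod_symm _ (by rwa [← Measure.volume_eq_prod])]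
  unfold intensity pairMask
  congr 1
  refine integral_congr_ae (Eventually.of_forall fun η => ?_)
  refine integral_congr_ae (Eventually.of_forall fun ξ => ?_)
  simp only [Complex.real_smul]
  push_cast
  ring

theorem norm_le_of_mem_admissible (hu : u ∈ admissible R) :
    ‖u‖ ≤ (volume (Metric.ball (0 : Plane) R)).toReal := by
  rw [L1.norm_eq_integral_norm]
  calc ∫ x, ‖u x‖ ≤ ∫ x, (Metric.ball (0 : Plane) R).indicator (fun _ => (1 : ℝ)) x := by
        refine integral_mono_ae (L1.integrable_coeFn u).norm
          ((integrableOn_const measure_ball_lt_top.ne).integrable_indicator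
            measurableSet_ball) ?_
        filter_upwards [hu.1, hu.2] with x hx hx'
        by_cases h : x ∈ Metric.ball (0 : Plane) R
        · simpa [h, abs_of_nonneg hx.1] using hx.2
        · simp [h, hx' h]
    _ = _ := by simp [integral_indicator measurableSet_ball, Measure.real]

theorem hasFDerivAt_intensity (hK : ContDiff ℝ 1 K) (hJ : Continuous J)
    (hu : u ∈ admissible R) (x : Plane) :
    HasFDerivAt (intensity K J u) (∫ p, pairMask u p • kernelDeriv K J x p) x := by
  have : intensity K J u = fun x => ∫ p, pairMask u p • kernel K J x p :=
    funext (intensity_eq_integral hK hJ hu)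
  rw [this]
  exact hasFDerivAt_integral_smul_of_ae_eq_zero (integrable_pairMask u) (pairMask_ae_eq_zero hu)
    (continuous_kernel hK hJ) (continuous_kernelDeriv hK hJ) (hasFDerivAt_kernel hK) x

theorem norm_gradient_sub (F G : Plane → ℝ) (x y : Plane) :
    ‖gradient F x - gradient G y‖ = ‖fderiv ℝ F x - fderiv ℝ G y‖ := by
  rw [gradient, gradient, ← map_sub, LinearIsometryEquiv.norm_map]

/-- The modulus does not depend on `u` because the pair masks have mass at most `|B_R|²` and share
one compact support. -/
theorem gradient_intensity_equicontinuous (hK : ContDiff ℝ 1 K) (hJ : Continuous J)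
    (R ρ : ℝ) {δ : ℝ} (hδ : 0 < δ) :
    ∃ r > 0, ∀ u ∈ admissible R, ∀ x ∈ Metric.closedBall (0 : Plane) ρ,
      ∀ y ∈ Metric.closedBall (0 : Plane) ρ, dist x y < r →
        ‖gradient (intensity K J u) x - gradient (intensity K J u) y‖ ≤ δ := by
  set V := (volume (Metric.ball (0 : Plane) R)).toReal
  obtain ⟨r, hr, h⟩ := exists_norm_integral_smul_sub_le (μ := volume) R ρ
    (continuous_kernelDeriv hK hJ) hδ (sq_nonneg V)
  refine ⟨r, hr, fun u hu x hx y hy hxy => ?_⟩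
  rw [norm_gradient_sub, (hasFDerivAt_intensity hK hJ hu x).fderiv,
    (hasFDerivAt_intensity hK hJ hu y).fderiv]
  refine h _ (integrable_pairMask u) (pairMask_ae_eq_zero hu) ?_ x hx y hy hxy
  rw [integral_norm_pairMask]
  exact pow_le_pow_left₀ (norm_nonneg _) (norm_le_of_mem_admissible hu) 2

theorem contDiff_intensity (hK : ContDiff ℝ 1 K) (hJ : Continuous J)
    (hu : u ∈ admissible R) : ContDiff ℝ 1 (intensity K J u) := by
  refine contDiff_one_iff_fderiv.2
    ⟨fun x => (hasFDerivAt_intensity hK hJ hu x).differentiableAt, ?_⟩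
  refine continuous_iff_continuousAt.2 fun x => Metric.continuousAt_iff.2 fun ε hε => ?_
  obtain ⟨r, hr, h⟩ := gradient_intensity_equicontinuous hK hJ R (‖x‖ + 1) (half_pos hε)
  refine ⟨min r 1, lt_min hr one_pos, fun y hy => ?_⟩
  rw [dist_eq_norm, ← norm_gradient_sub]
  refine (h u hu y ?_ x ?_ (hy.trans_le (min_le_left _ _))).trans_lt (half_lt_self hε)
  · rw [mem_closedBall_zero_iff]
    have := norm_le_norm_add_norm_sub' y x
    rw [← dist_eq_norm] at this
    linarith [hy.trans_le (min_le_right r 1)]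
  · simp

theorem intensity_lipschitz (hK : ContDiff ℝ 1 K) (hJ : Continuous J) (R ρ : ℝ) :
    ∃ M > 0, ∀ u ∈ admissible R, ∀ v ∈ admissible R, ∀ x ∈ Metric.closedBall (0 : Plane) ρ,
      |intensity K J u x - intensity K J v x| ≤ M * ‖u - v‖ ∧
        ‖gradient (intensity K J u) x - gradient (intensity K J v) x‖ ≤ M * ‖u - v‖ := by
  set V := (volume (Metric.ball (0 : Plane) R)).toReal
  have hc := (isCompact_closedBall (0 : Plane) ρ).prod
    (isCompact_closedBall (0 : Plane × Plane) R)
  obtain ⟨M₀, hM₀⟩ := hc.exists_bound_of_continuousOn (continuous_kernel hK hJ).continuousOn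
  obtain ⟨M₁, hM₁⟩ := hc.exists_bound_of_continuousOn (continuous_kernelDeriv hK hJ).continuousOn
  set M := max 1 (max M₀ M₁)
  have hM : 0 < M := lt_of_lt_of_le one_pos (le_max_left _ _)
  have hV : 0 ≤ V := ENNReal.toReal_nonneg
  refine ⟨M * (V + V + 1), by positivity, fun u hu v hv x hx => ?_⟩
  have hfin : ∀ m ≤ M, m * ∫ p, ‖pairMask u p - pairMask v p‖ ≤ M * (V + V + 1) * ‖u - v‖ := by
    intro m hm
    rw [mul_assoc]
    refine mul_le_mul hm ((integral_norm_pairMask_sub_le u v).trans ?_)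
      (integral_nonneg fun _ => norm_nonneg _) hM.le
    refine mul_le_mul_of_nonneg_right ?_ (norm_nonneg _)
    linarith [norm_le_of_mem_admissible hu, norm_le_of_mem_admissible hv]
  constructor
  · rw [intensity_eq_integral hK hJ hu, intensity_eq_integral hK hJ hv]
    exact (norm_integral_smul_sub_le_of_ae_eq_zero (integrable_pairMask u) (integrable_pairMask v)
      (pairMask_ae_eq_zero hu) (pairMask_ae_eq_zero hv)
      ((continuous_kernel hK hJ).comp (Continuous.prodMk_right x))
      fun p hp => hM₀ (x, p) ⟨hx, hp⟩).trans
      (hfin M₀ ((le_max_left _ _).trans (le_max_right _ _)))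
  · rw [norm_gradient_sub, (hasFDerivAt_intensity hK hJ hu x).fderiv,
      (hasFDerivAt_intensity hK hJ hv x).fderiv]
    exact (norm_integral_smul_sub_le_of_ae_eq_zero (integrable_pairMask u) (integrable_pairMask v)
      (pairMask_ae_eq_zero hu) (pairMask_ae_eq_zero hv)
      ((continuous_kernelDeriv hK hJ).comp (Continuous.prodMk_right x))
      fun p hp => hM₁ (x, p) ⟨hx, hp⟩).trans
      (hfin M₁ ((le_max_right _ _).trans (le_max_right _ _)))

/-- The intensities of admissible masks decay uniformly at infinity. -/
theorem exists_exposed_subset_ball (hK : ContDiff ℝ 1 K) (hJ : Continuous J)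
    (hK0 : Tendsto K (cocompact Plane) (𝓝 0)) (R : ℝ) {h : ℝ} (hh : 0 < h) :
    ∃ R₁, R ≤ R₁ ∧ ∀ u ∈ admissible R, exposed K J h u ⊆ Metric.ball (0 : Plane) R₁ := by
  set V := (volume (Metric.ball (0 : Plane) R)).toReal
  obtain ⟨N, hN⟩ := (isCompact_closedBall (0 : Plane × Plane) R).exists_bound_of_continuousOn
    (f := fun p : Plane × Plane => J (p.1 - p.2)) (by fun_prop)
  set B := max N 0 * V ^ 2 + 1
  have hB : 0 < B := by positivity
  -- One factor `K` supplies the smallness `ε`; the bound `ε ≤ 1` disposes of the other.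
  set ε := min 1 (h / B)
  have hε : 0 < ε := lt_min one_pos (by positivity)
  have hK1 : ∀ᶠ z in cocompact Plane, ‖K z‖ < ε := by
    have := hK0.eventually (Metric.ball_mem_nhds 0 hε)
    simpa using this
  obtain ⟨ρ, -, hρ⟩ := (Metric.hasBasis_cobounded_compl_closedBall (0 : Plane)).eventually_iff.1
    (Metric.cobounded_eq_cocompact (α := Plane) ▸ hK1)
  -- If `‖x‖ ≥ ρ + R + 1` and `‖q‖ ≤ R`, then `‖x - q‖ > ρ`, where `K` is small.
  refine ⟨max R (ρ + R + 1), le_max_left _ _, fun u hu x hx => ?_⟩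
  by_contra hxR
  have hx' : ρ + R + 1 ≤ ‖x‖ := by
    rw [mem_ball_zero_iff, not_lt] at hxR
    exact (le_max_right _ _).trans hxR
  have hz : ∀ q : Plane, ‖q‖ ≤ R → ‖K (x - q)‖ ≤ ε := fun q hq => by
    refine (hρ ?_).le
    rw [Set.mem_compl_iff, mem_closedBall_zero_iff, not_le]
    linarith [norm_sub_norm_le x q]
  have hb : ∀ p ∈ Metric.closedBall (0 : Plane × Plane) R, ‖kernel K J x p‖ ≤ ε * max N 0 := by
    intro p hp
    have hp' := mem_closedBall_zero_iff.1 hp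
    rw [Prod.norm_def, max_le_iff] at hp'
    have h1 := hz _ hp'.1
    have h2 := hz _ hp'.2
    refine (Complex.abs_re_le_norm _).trans ?_
    rw [norm_mul, norm_mul, RCLike.norm_conj]
    calc ‖K (x - p.1)‖ * ‖J (p.1 - p.2)‖ * ‖K (x - p.2)‖ ≤ ε * max N 0 * 1 := by
          gcongr
          · exact (hN p hp).trans (le_max_left _ _)
          · exact h2.trans (min_le_left _ _)
      _ = _ := mul_one _
  have hI : ‖intensity K J u x‖ ≤ ε * max N 0 * V ^ 2 := by
    rw [intensity_eq_integral hK hJ hu]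
    refine (norm_integral_smul_le_of_ae_eq_zero (integrable_pairMask u)
      (pairMask_ae_eq_zero hu) hb).trans ?_
    rw [integral_norm_pairMask]
    gcongr
    exact norm_le_of_mem_admissible hu
  have hxh : h < intensity K J u x := hx
  have h3 : ε * (max N 0 * V ^ 2) ≤ ε * B := by
    gcongr
    exact le_add_of_nonneg_right zero_le_one
  have h4 : ε * B ≤ h := by
    calc ε * B ≤ h / B * B := by gcongr; exact min_le_right _ _
      _ = h := by field_simp
  have := (le_abs_self _).trans hI
  nlinarith

end Intensity

/-! ### Divergence and integration by parts -/

section Divergence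

variable {X Y : Plane → Plane} {D : Set Plane}

theorem divergence_eq_zero_of_notMem_tsupport {x : Plane} (hx : x ∉ tsupport X) :
    divergence X x = 0 := by
  simp [divergence, fderiv_of_notMem_tsupport ℝ hx]

theorem continuous_divergence (hX : ContDiff ℝ 1 X) : Continuous (divergence X) := by
  have h := hX.continuous_fderiv one_ne_zero
  unfold divergence
  fun_prop

theorem hasCompactSupport_divergence (hX : HasCompactSupport X) :
    HasCompactSupport (divergence X) :=
  HasCompactSupport.intro hX fun _ hx => divergence_eq_zero_of_notMem_tsupport hx

theorem integrable_divergence (hX : ContDiff ℝ 1 X) (hXc : HasCompactSupport X) :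
    Integrable (divergence X) :=
  (continuous_divergence hX).integrable_of_hasCompactSupport (hasCompactSupport_divergence hXc)

theorem divergence_sub (hX : ContDiff ℝ 1 X) (hY : ContDiff ℝ 1 Y) (x : Plane) :
    divergence (X - Y) x = divergence X x - divergence Y x := by
  simp [divergence, fderiv_sub (hX.differentiable one_ne_zero x) (hY.differentiable one_ne_zero x)]

theorem divergence_const_smul (hX : ContDiff ℝ 1 X) (c : ℝ) (x : Plane) :
    divergence (c • X) x = c * divergence X x := by
  simp [divergence, fderiv_const_smul (hX.differentiable one_ne_zero x), mul_add]

theorem abs_divergence_le (X : Plane → Plane) (x : Plane) :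
    |divergence X x| ≤ 2 * ‖fderiv ℝ X x‖ := by
  have h : ∀ i : Fin 2, |(fderiv ℝ X x (EuclideanSpace.single i 1)) i| ≤ ‖fderiv ℝ X x‖ :=
    fun i => (PiLp.norm_apply_le _ i).trans
      (((fderiv ℝ X x).le_opNorm _).trans (by simp))
  calc |divergence X x| ≤ ∑ i : Fin 2, |(fderiv ℝ X x (EuclideanSpace.single i 1)) i| :=
        Finset.abs_sum_le_sum_abs _ _
    _ ≤ ∑ _i : Fin 2, ‖fderiv ℝ X x‖ := Finset.sum_le_sum fun i _ => h i
    _ = _ := by simp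

/-- Integration by parts for a compactly supported field. -/
theorem integral_mul_divergence {g : Plane → ℝ} (hg : ContDiff ℝ 1 g) (hX : ContDiff ℝ 1 X)
    (hXc : HasCompactSupport X) :
    ∫ x, g x * divergence X x = -∫ x, ⟪gradient g x, X x⟫_ℝ := by
  have hg1 := hg.continuous_fderiv one_ne_zero
  have hX1 := hX.continuous_fderiv one_ne_zero
  have hX0 := hX.continuous
  have hg0 := hg.continuous
  have hXi : ∀ (i : Fin 2) (x : Plane), HasFDerivAt (fun x => X x i)
      ((EuclideanSpace.proj i : Plane →L[ℝ] ℝ).comp (fderiv ℝ X x)) x := fun i x =>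
    (EuclideanSpace.proj i : Plane →L[ℝ] ℝ).hasFDerivAt.comp x
      (hX.differentiable one_ne_zero x).hasFDerivAt
  have i1 : ∀ i : Fin 2, Integrable
      fun x => g x * (fderiv ℝ X x (EuclideanSpace.single i 1)) i := fun i =>
    Continuous.integrable_of_hasCompactSupport (by fun_prop)
      (HasCompactSupport.intro hXc fun x hx => by simp [fderiv_of_notMem_tsupport ℝ hx])
  have i2 : ∀ i : Fin 2, Integrable
      fun x => fderiv ℝ g x (EuclideanSpace.single i 1) * X x i := fun i =>
    Continuous.integrable_of_hasCompactSupport (by fun_prop)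
      (HasCompactSupport.intro hXc fun x hx => by simp [image_eq_zero_of_notMem_tsupport hx])
  have i3 : ∀ i : Fin 2, Integrable fun x => g x * X x i := fun i =>
    Continuous.integrable_of_hasCompactSupport (by fun_prop)
      (HasCompactSupport.intro hXc fun x hx => by simp [image_eq_zero_of_notMem_tsupport hx])
  have key : ∀ i : Fin 2, ∫ x, g x * (fderiv ℝ X x (EuclideanSpace.single i 1)) i =
      -∫ x, fderiv ℝ g x (EuclideanSpace.single i 1) * X x i := fun i =>
    integral_bilinear_hasFDerivAt_right_eq_neg_left_of_integrable
      (B := ContinuousLinearMap.mul ℝ ℝ) (i2 i) (i1 i) (i3 i)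
      (fun x _ => (hg.differentiable one_ne_zero x).hasFDerivAt) fun x _ => hXi i x
  have hin : ∀ x, ⟪gradient g x, X x⟫_ℝ =
      ∑ i : Fin 2, fderiv ℝ g x (EuclideanSpace.single i 1) * X x i := fun x => by
    have hsum : X x = ∑ i : Fin 2, X x i • EuclideanSpace.single i (1 : ℝ) := by
      ext j
      fin_cases j <;> simp
    rw [gradient, InnerProductSpace.toDual_symm_apply]
    conv_lhs => rw [hsum]
    rw [map_sum]
    exact Finset.sum_congr rfl fun i _ => by rw [map_smul, smul_eq_mul, mul_comm]
  simp_rw [hin, divergence, Finset.mul_sum]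
  rw [integral_finsetSum _ fun i _ => i1 i, integral_finsetSum _ fun i _ => i2 i,
    ← Finset.sum_neg_distrib]
  exact Finset.sum_congr rfl fun i _ => key i

theorem gradient_comp {F : Plane → ℝ} {H : ℝ → ℝ} {b : ℝ} {x : Plane}
    (hF : DifferentiableAt ℝ F x) (hH : HasDerivAt H b (F x)) :
    gradient (fun x => H (F x)) x = b • gradient F x := by
  have : HasFDerivAt (fun x => H (F x)) (b • fderiv ℝ F x) x :=
    hH.comp_hasFDerivAt x hF.hasFDerivAt
  rw [gradient, this.fderiv, map_smul, gradient]

theorem continuous_gradient {F : Plane → ℝ} (hF : ContDiff ℝ 1 F) : Continuous (gradient F) :=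
  (InnerProductSpace.toDual ℝ Plane).symm.continuous.comp (hF.continuous_fderiv one_ne_zero)

/-- Stands in for the coarea formula: a steep step `H` isolates a superlevel set, the primitive of a
bump isolates a level strip. -/
theorem integral_comp_mul_divergence {F : Plane → ℝ} {H : ℝ → ℝ} (hH : ContDiff ℝ 1 H)
    (hF : ContDiff ℝ 1 F) (hX : ContDiff ℝ 1 X) (hXc : HasCompactSupport X) :
    ∫ x, H (F x) * divergence X x = -∫ x, deriv H (F x) * ⟪gradient F x, X x⟫_ℝ := by
  refine (integral_mul_divergence (hH.comp hF) hX hXc).trans ?_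
  congr 2
  ext x
  simp only [Function.comp_def]
  rw [gradient_comp (hF.differentiable one_ne_zero x)
    (hH.differentiable one_ne_zero (F x)).hasDerivAt, real_inner_smul_left]

end Divergence

/-! ### Perimeter of superlevel sets and area of level strips -/

section SuperlevelSet

variable {F : Plane → ℝ} {h : ℝ}

/-- A field that points out of a superlevel set near its boundary has nonnegative flux. -/
theorem setIntegral_divergence_nonneg {Z : Plane → Plane} {t : ℝ} (ht : 0 < t)
    (hF : ContDiff ℝ 1 F) (hZ : ContDiff ℝ 1 Z) (hZc : HasCompactSupport Z)
    (hFZ : ∀ x, h < F x → F x < h + t → ⟪gradient F x, Z x⟫_ℝ ≤ 0) :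
    0 ≤ ∫ x in {x | h < F x}, divergence Z x := by
  -- Smooth steps from `0` at `h` to `1` at `h + t / (n + 1)`: they converge to the indicator of
  -- `(h, ∞)`, and their slope lives where `hFZ` applies.
  set H : ℕ → ℝ → ℝ := fun n s => Real.smoothTransition ((s - h) * ((n + 1) / t)) with hH
  have hpos : ∀ n : ℕ, 0 < ((n : ℝ) + 1) / t := fun n => by positivity
  have hHc : ∀ n, ContDiff ℝ 1 (H n) := fun n =>
    Real.smoothTransition.contDiff.comp (by fun_prop)
  have hHm : ∀ n, Monotone (H n) := fun n a b hab =>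
    Real.smoothTransition.monotone
      (mul_le_mul_of_nonneg_right (sub_le_sub_right hab h) (hpos n).le)
  have hH0 : ∀ n s, s ≤ h → H n s = 0 := fun n s hs =>
    Real.smoothTransition.zero_of_nonpos (mul_nonpos_of_nonpos_of_nonneg (by linarith) (hpos n).le)
  have hH1 : ∀ (n : ℕ) s, h + t / (n + 1) ≤ s → H n s = 1 := fun n s hs => by
    refine Real.smoothTransition.one_of_one_le ?_
    have h1 : t / (n + 1) ≤ s - h := by linarith
    calc (1 : ℝ) = t / (n + 1) * ((n + 1) / t) := by field_simp
      _ ≤ _ := mul_le_mul_of_nonneg_right h1 (hpos n).le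
  -- Each such `s` is a global minimum of `H n`, which covers the endpoint `s = h` too; maxima serve
  -- likewise on the other side.
  have hd0 : ∀ n s, s ≤ h → deriv (H n) s = 0 := fun n s hs =>
    IsLocalMin.deriv_eq_zero (Eventually.of_forall fun y => by
      rw [hH0 n s hs]; exact Real.smoothTransition.nonneg _)
  have hd1 : ∀ n s, h + t ≤ s → deriv (H n) s = 0 := fun n s hs =>
    IsLocalMax.deriv_eq_zero (Eventually.of_forall fun y => by
      rw [hH1 n s (le_trans (by gcongr; exact div_le_self ht.le (by simp)) hs)]
      exact Real.smoothTransition.le_one _)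
  have hn : ∀ n, 0 ≤ ∫ x, H n (F x) * divergence Z x := fun n => by
    rw [integral_comp_mul_divergence (hHc n) hF hZ hZc, ← integral_neg]
    refine integral_nonneg fun x => ?_
    rw [Pi.zero_apply, neg_nonneg]
    by_cases h0 : F x ≤ h
    · simp [hd0 n _ h0]
    by_cases h1 : h + t ≤ F x
    · simp [hd1 n _ h1]
    · exact mul_nonpos_of_nonneg_of_nonpos (hHm n).deriv_nonneg
        (hFZ x (not_le.1 h0) (not_le.1 h1))
  have hlim : Tendsto (fun n => ∫ x, H n (F x) * divergence Z x) atTop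
      (𝓝 (∫ x, {x | h < F x}.indicator (divergence Z) x)) := by
    have hcF := hF.continuous
    have hcZ := continuous_divergence hZ
    refine tendsto_integral_of_dominated_convergence (fun x => ‖divergence Z x‖)
      (fun n => (((hHc n).continuous.comp hcF).mul hcZ).aestronglyMeasurable)
      (integrable_divergence hZ hZc).norm (fun n => Eventually.of_forall fun x => ?_)
      (Eventually.of_forall fun x => ?_)
    · rw [norm_mul]
      refine mul_le_of_le_one_left (norm_nonneg _) ?_
      rw [Real.norm_of_nonneg (Real.smoothTransition.nonneg _)]
      exact Real.smoothTransition.le_one _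
    · refine tendsto_const_nhds.congr' ?_
      by_cases hx : h < F x
      · have : Tendsto (fun n : ℕ => h + t / ((n : ℝ) + 1)) atTop (𝓝 (h + 0)) :=
          (tendsto_const_div_atTop_nhds_zero_nat t |>.comp (tendsto_add_atTop_nat 1)
            |>.congr fun n => by simp).const_add h
        rw [add_zero] at this
        filter_upwards [this.eventually_le_const hx] with n hnx
        rw [hH1 n _ hnx, one_mul, Set.indicator_of_mem (by exact hx)]
      · refine Eventually.of_forall fun n => ?_
        beta_reduce
        rw [hH0 n _ (not_lt.1 hx), zero_mul, Set.indicator_of_notMem (by exact hx)]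
  rw [← integral_indicator (measurableSet_lt measurable_const hF.continuous.measurable)]
  exact ge_of_tendsto' hlim hn

/-- `div X` vanishes off `D`, so `Ω` may stick out of `D`. -/
theorem setIntegral_indicator_mul_divergence {D Ω : Set Plane} (hΩ : MeasurableSet Ω)
    {X : Plane → Plane} (hX : tsupport X ⊆ D) :
    ∫ x in D, Ω.indicator 1 x * divergence X x = ∫ x in Ω, divergence X x := by
  rw [← integral_indicator hΩ]
  rw [setIntegral_eq_integral_of_forall_compl_eq_zero]
  · congr 1
    ext x
    by_cases hx : x ∈ Ω <;> simp [hx]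
  · intro x hx
    rw [divergence_eq_zero_of_notMem_tsupport fun h => hx (hX h), mul_zero]

theorem ofReal_setIntegral_divergence_le_variation {D Ω : Set Plane} (hΩ : MeasurableSet Ω)
    {X : Plane → Plane} (hX : IsTestField D X) :
    ENNReal.ofReal (∫ x in Ω, divergence X x) ≤ variation D (Ω.indicator 1) := by
  rw [← setIntegral_indicator_mul_divergence hΩ hX.support_subset]
  exact le_iSup₂_of_le X hX le_rfl

/-- A field that nearly calibrates the boundary of a superlevel set nearly realizes its
perimeter. -/
theorem variation_superlevel_le {D : Set Plane} {X : Plane → Plane} {t c : ℝ} (ht : 0 < t)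
    (hF : ContDiff ℝ 1 F) (hX : ContDiff ℝ 1 X) (hXc : HasCompactSupport X)
    (hFX : ∀ x, h < F x → F x < h + t → ‖gradient F x‖ ≤ c * -⟪gradient F x, X x⟫_ℝ) :
    variation D ({x | h < F x}.indicator 1) ≤
      ENNReal.ofReal (c * ∫ x in {x | h < F x}, divergence X x) := by
  refine iSup₂_le fun Y hY => ENNReal.ofReal_le_ofReal ?_
  rw [setIntegral_indicator_mul_divergence
    (measurableSet_lt measurable_const hF.continuous.measurable) hY.support_subset]
  have hcX : ContDiff ℝ 1 (c • X) := contDiff_const.smul hX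
  have hcc : HasCompactSupport (c • X) := HasCompactSupport.intro hXc fun x hx => by
    simp [image_eq_zero_of_notMem_tsupport hx]
  -- In the strip `⟨∇F, cX - Y⟩ ≤ -‖∇F‖ + ‖∇F‖ = 0`, so the flux of any competitor `Y` is at most
  -- `c` times that of `X`.
  have key := setIntegral_divergence_nonneg (h := h) (Z := c • X - Y) ht hF (hcX.sub hY.contDiff)
    (hcc.sub hY.compact_support) fun x h1 h2 => by
      have h3 := hFX x h1 h2
      have h4 := abs_real_inner_le_norm (gradient F x) (Y x)
      have h5 := mul_le_of_le_one_right (norm_nonneg (gradient F x)) (hY.norm_le_one x)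
      have h6 := neg_abs_le ⟪gradient F x, Y x⟫_ℝ
      rw [Pi.sub_apply, inner_sub_right, Pi.smul_apply, real_inner_smul_right]
      linarith
  simp_rw [divergence_sub hcX hY.contDiff, divergence_const_smul hX] at key
  rw [integral_sub ((integrable_divergence hX hXc).const_mul c).integrableOn
    (integrable_divergence hY.contDiff hY.compact_support).integrableOn, integral_const_mul] at key
  linarith

theorem abs_setIntegral_divergence_le {D Ω : Set Plane} (hD : volume D ≠ ∞) {X : Plane → Plane}
    (hX : tsupport X ⊆ D) (hΩ : MeasurableSet Ω) {L : ℝ} (hL : ∀ x, |divergence X x| ≤ L) :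
    |∫ x in Ω, divergence X x| ≤ L * volume.real D := by
  rw [← setIntegral_indicator_mul_divergence hΩ hX]
  rw [← Real.norm_eq_abs]
  refine norm_setIntegral_le_of_norm_le_const hD.lt_top fun x _ => ?_
  rw [norm_mul]
  refine (mul_le_of_le_one_left (norm_nonneg _) ?_).trans (hL x)
  by_cases hx : x ∈ Ω <;> simp [hx]

/-- The area of a level strip is controlled by its width as soon as a field crosses it with
speed bounded below. -/
theorem measureReal_strip_le {D : Set Plane} {X : Plane → Plane} {κ m L : ℝ} (hκ : 0 < κ)
    (hm : 0 < m) (hF : ContDiff ℝ 1 F) (hX : IsTestField D X) (hD : volume D ≠ ∞)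
    (hL : ∀ x, |divergence X x| ≤ L)
    (hFX : ∀ x, |F x - h| ≤ 2 * κ → m ≤ -⟪gradient F x, X x⟫_ℝ) :
    volume {x | |F x - h| ≤ κ} ≠ ∞ ∧
      volume.real {x | |F x - h| ≤ κ} ≤ 4 * κ * L * volume.real D / m := by
  set S := {x | |F x - h| ≤ κ}
  have hcF := hF.continuous
  have hSm : MeasurableSet S := (isClosed_le (by fun_prop) continuous_const).measurableSet
  -- Where `X` vanishes the pairing is `0 < m`, so the strip lies in the support of `X`.
  have hS : S ⊆ D := fun x hx => by
    refine hX.support_subset (by_contra fun hxX => ?_)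
    have := hFX x (le_trans hx (by linarith))
    rw [image_eq_zero_of_notMem_tsupport hxX, inner_zero_right] at this
    linarith
  have hSfin : volume S ≠ ∞ := (measure_mono hS |>.trans_lt hD.lt_top).ne
  refine ⟨hSfin, ?_⟩
  -- The bump is `1` on the strip, and its primitive `H` is at most `4κ` in absolute value, the
  -- length of the interval carrying `b`. Parts then gives `m |S| ≤ ∫ H(F) div X ≤ 4κ L |D|`.
  let b : ContDiffBump h := ⟨κ, 2 * κ, hκ, by linarith⟩
  have hbc : Continuous b := b.continuous
  set H : ℝ → ℝ := fun s => ∫ τ in (h - 2 * κ)..s, b τ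
  have hHd : ∀ s, HasDerivAt H (b s) s := fun s =>
    intervalIntegral.integral_hasDerivAt_right (hbc.intervalIntegrable _ _)
      (hbc.stronglyMeasurableAtFilter _ _) hbc.continuousAt
  have hHc : ContDiff ℝ 1 H := contDiff_one_iff_deriv.2
    ⟨fun s => (hHd s).differentiableAt, by rwa [show deriv H = b from funext fun s => (hHd s).deriv]⟩
  have hHb : ∀ s, |H s| ≤ 4 * κ := fun s => by
    rw [← Real.norm_eq_abs]
    refine (intervalIntegral.norm_integral_le_integral_norm_uIoc).trans ?_
    calc ∫ τ in Set.uIoc (h - 2 * κ) s, ‖b τ‖ ≤ ∫ τ, ‖b τ‖ :=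
          setIntegral_le_integral (hbc.integrable_of_hasCompactSupport b.hasCompactSupport).norm
            (Eventually.of_forall fun _ => norm_nonneg _)
      _ = ∫ τ, b τ := by simp_rw [Real.norm_of_nonneg b.nonneg]
      _ ≤ volume.real (Metric.closedBall h (2 * κ)) := b.integral_le_measure_closedBall volume
      _ = 4 * κ := by
          rw [Measure.real, Real.volume_closedBall, ENNReal.toReal_ofReal (by linarith)]; ring
  have hparts := integral_comp_mul_divergence hHc hF hX.contDiff hX.compact_support
  simp_rw [fun s => (hHd s).deriv] at hparts
  have hcX := hX.contDiff.continuous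
  have hcg := continuous_gradient hF
  have hi : Integrable fun x => b (F x) * -⟪gradient F x, X x⟫_ℝ :=
    Continuous.integrable_of_hasCompactSupport (by fun_prop)
      (HasCompactSupport.intro hX.compact_support fun x hx => by
        simp [image_eq_zero_of_notMem_tsupport hx])
  have hlow : m * volume.real S ≤ ∫ x, b (F x) * -⟪gradient F x, X x⟫_ℝ := by
    calc m * volume.real S = ∫ x, S.indicator (fun _ => m) x := by
          rw [integral_indicator hSm, setIntegral_const, smul_eq_mul, mul_comm]
      _ ≤ _ := by
          refine integral_mono ((integrableOn_const hSfin).integrable_indicator hSm) hi fun x => ?_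
          by_cases hx : x ∈ S
          · have hb1 : b (F x) = 1 := b.one_of_mem_closedBall (by
              rw [Metric.mem_closedBall, Real.dist_eq]; exact hx)
            simp only [Set.indicator_of_mem hx, hb1, one_mul]
            exact hFX x (le_trans hx (by linarith))
          · simp only [Set.indicator_of_notMem hx]
            by_cases hx2 : |F x - h| ≤ 2 * κ
            · exact mul_nonneg b.nonneg (hm.le.trans (hFX x hx2))
            · rw [b.zero_of_le_dist (by rw [Real.dist_eq]; exact (not_le.1 hx2).le), zero_mul]
  have hup : ∫ x, b (F x) * -⟪gradient F x, X x⟫_ℝ ≤ 4 * κ * L * volume.real D := by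
    simp_rw [mul_neg, integral_neg]
    rw [← hparts, ← setIntegral_eq_integral_of_forall_compl_eq_zero (s := D) fun x hx => by
      rw [divergence_eq_zero_of_notMem_tsupport fun h => hx (hX.support_subset h), mul_zero]]
    refine (Real.le_norm_self _).trans (norm_setIntegral_le_of_norm_le_const hD.lt_top fun x _ => ?_)
    rw [norm_mul]
    exact mul_le_mul (hHb _) (hL x) (norm_nonneg _) (by linarith)
  rw [le_div_iff₀ hm]
  linarith

end SuperlevelSet

/-! ### Mollified normals as approximate calibrations -/

section NormalField

/-- The inner unit normal field of the level sets of `F`, truncated to a ball. -/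
noncomputable def unitNormal (F : Plane → ℝ) (ρ : ℝ) : Plane → Plane :=
  (Metric.closedBall (0 : Plane) ρ).indicator fun y => ‖gradient F y‖⁻¹ • gradient F y

theorem norm_unitNormal_le (F : Plane → ℝ) (ρ : ℝ) (y : Plane) : ‖unitNormal F ρ y‖ ≤ 1 := by
  unfold unitNormal
  by_cases hy : y ∈ Metric.closedBall (0 : Plane) ρ
  · rw [Set.indicator_of_mem hy, norm_smul, norm_inv, norm_norm]
    exact inv_mul_le_one
  · simp [hy]

theorem inner_unitNormal {F : Plane → ℝ} {ρ : ℝ} {y : Plane}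
    (hy : y ∈ Metric.closedBall (0 : Plane) ρ) :
    ⟪gradient F y, unitNormal F ρ y⟫_ℝ = ‖gradient F y‖ := by
  rw [unitNormal, Set.indicator_of_mem hy, real_inner_smul_right, real_inner_self_eq_norm_sq]
  -- At a critical point `0⁻¹ = 0` makes the field zero, and both sides vanish.
  by_cases h : ‖gradient F y‖ = 0
  · simp [h]
  · field_simp

/-- The field can jump at critical points and at the truncation; being bounded and measurable
suffices for convolution with a smooth kernel. -/
theorem locallyIntegrable_unitNormal {F : Plane → ℝ} (hF : ContDiff ℝ 1 F) (ρ : ℝ) :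
    LocallyIntegrable (unitNormal F ρ) := by
  have hg := (continuous_gradient hF).measurable
  have hm : Measurable (unitNormal F ρ) :=
    (hg.norm.inv.smul hg).indicator Metric.isClosed_closedBall.measurableSet
  exact (locallyIntegrable_const (1 : ℝ)).mono hm.aestronglyMeasurable
    (Eventually.of_forall fun y => by simpa using norm_unitNormal_le F ρ y)

open scoped Convolution in
/-- Mollifying the unit normal gives test fields that almost calibrate the level sets of `F`,
with a bound on their divergence that does not depend on `F`. -/
theorem exists_calibrating_field (ρ : ℝ) {r : ℝ} (hr : 0 < r) :
    ∃ L : ℝ, 0 ≤ L ∧ ∀ (F : Plane → ℝ) (δ : ℝ), ContDiff ℝ 1 F →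
      (∀ x ∈ Metric.closedBall (0 : Plane) (ρ + 2 * r),
        ∀ y ∈ Metric.closedBall (0 : Plane) (ρ + 2 * r), dist x y < r →
          ‖gradient F x - gradient F y‖ ≤ δ) →
      ∃ X, IsTestField (Metric.ball (0 : Plane) (ρ + 4 * r)) X ∧
        (∀ x, |divergence X x| ≤ L) ∧
        ∀ x ∈ Metric.closedBall (0 : Plane) ρ,
          ‖gradient F x‖ - 2 * δ ≤ -⟪gradient F x, X x⟫_ℝ := by
  let b : ContDiffBump (0 : Plane) := ⟨r / 2, r, by linarith, by linarith⟩
  set k : Plane → ℝ := b.normed volume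
  have hkc : HasCompactSupport k := b.hasCompactSupport_normed
  have hk : ContDiff ℝ 1 k := b.contDiff_normed
  have hk0 : ∀ t, 0 ≤ k t := b.nonneg_normed
  have hk1 : ∫ t, k t = 1 := b.integral_normed
  have hki : Integrable k := hk.continuous.integrable_of_hasCompactSupport hkc
  have hks : ∀ t, k t ≠ 0 → ‖t‖ < r := fun t ht => by
    have : t ∈ Function.support k := ht
    rw [b.support_normed_eq] at this
    exact mem_ball_zero_iff.1 this
  have hk' : Integrable (fderiv ℝ k) :=
    (hk.continuous_fderiv one_ne_zero).integrable_of_hasCompactSupport (hkc.fderiv ℝ)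
  set A := (ContinuousLinearMap.lsmul ℝ ℝ : ℝ →L[ℝ] Plane →L[ℝ] Plane)
  -- The derivative falls on the kernel and `‖N‖ ≤ 1`, so the bound sees only `r`; the factor `2` is
  -- from `abs_divergence_le`.
  refine ⟨2 * (‖A.precompL Plane‖ * ∫ t, ‖fderiv ℝ k t‖), by positivity, fun F δ hF hδ => ?_⟩
  set N := unitNormal F (ρ + 2 * r)
  have hN : LocallyIntegrable N := locallyIntegrable_unitNormal hF _
  have hN1 : ∀ y, ‖N y‖ ≤ 1 := norm_unitNormal_le F _
  set Y : Plane → Plane := k ⋆[A, volume] N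
  have hYx : ∀ x, Y x = ∫ t, k t • N (x - t) := fun x => rfl
  have hYi : ∀ x, Integrable fun t => k t • N (x - t) := fun x =>
    hkc.convolutionExists_left A hk.continuous hN x
  have hYc : ContDiff ℝ 1 Y := hkc.contDiff_convolution_left A (n := 1) hk hN
  have hY1 : ∀ x, ‖Y x‖ ≤ 1 := fun x => by
    rw [hYx, ← hk1]
    refine norm_integral_le_of_norm_le hki (Eventually.of_forall fun t => ?_)
    rw [norm_smul, Real.norm_of_nonneg (hk0 t)]
    exact mul_le_of_le_one_right (hk0 t) (hN1 _)
  have hYs : tsupport Y ⊆ Metric.closedBall 0 (ρ + 3 * r) := by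
    refine closure_minimal (fun x hx => ?_) Metric.isClosed_closedBall
    obtain ⟨s, hs, y, hy, rfl⟩ := support_convolution_subset A hx
    have hy' : y ∈ Metric.closedBall (0 : Plane) (ρ + 2 * r) := by
      by_contra hy'
      exact hy (Set.indicator_of_notMem hy' _)
    rw [mem_closedBall_zero_iff] at hy' ⊢
    linarith [norm_add_le s y, hks s hs]
  have hYd : ∀ x, ‖fderiv ℝ Y x‖ ≤ ‖A.precompL Plane‖ * ∫ t, ‖fderiv ℝ k t‖ := fun x => by
    rw [(hkc.hasFDerivAt_convolution_left A hk hN x).fderiv, ← integral_const_mul]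
    refine norm_integral_le_of_norm_le (hk'.norm.const_mul _) (Eventually.of_forall fun t => ?_)
    refine ((A.precompL Plane).le_opNorm₂ _ _).trans ?_
    exact mul_le_of_le_one_right (by positivity) (hN1 _)
  have hfn : ∀ x, fderiv ℝ (-Y) x = -fderiv ℝ Y x := fun x => fderiv_neg
  -- The gradient points into the superlevel set; the sign makes the field point outward.
  refine ⟨-Y, ⟨hYc.neg, ?_, ?_, fun x => by simpa using hY1 x⟩, fun x => ?_, fun x hx => ?_⟩
  · exact HasCompactSupport.intro (isCompact_closedBall (0 : Plane) (ρ + 3 * r)) fun x hx => by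
      simp [image_eq_zero_of_notMem_tsupport fun h => hx (hYs h)]
  · have : tsupport (-Y) = tsupport Y := by rw [tsupport, tsupport, Function.support_neg]
    rw [this]
    exact hYs.trans (Metric.closedBall_subset_ball (by linarith))
  · refine (abs_divergence_le _ x).trans ?_
    rw [hfn, norm_neg]
    exact mul_le_mul_of_nonneg_left (hYd x) zero_le_two
  · rw [Pi.neg_apply, inner_neg_right, neg_neg, hYx, ← integral_inner (hYi x)]
    have hx' := mem_closedBall_zero_iff.1 hx
    -- Pointwise `⟨∇F(x), N(x - t)⟩ ≥ ‖∇F(x - t)‖ - δ ≥ ‖∇F(x)‖ - 2δ`, then averaged against `k`.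
    calc ‖gradient F x‖ - 2 * δ = ∫ t, k t * (‖gradient F x‖ - 2 * δ) := by
          rw [integral_mul_const, hk1, one_mul]
      _ ≤ _ := by
          refine integral_mono (hki.mul_const _) ((hYi x).const_inner _) fun t => ?_
          simp only [real_inner_smul_right]
          by_cases ht : k t = 0
          · simp [ht]
          refine mul_le_mul_of_nonneg_left ?_ (hk0 t)
          have htr := hks t ht
          have hy : x - t ∈ Metric.closedBall (0 : Plane) (ρ + 2 * r) := by
            rw [mem_closedBall_zero_iff]
            linarith [norm_sub_le x t]
          have hd := hδ x (Metric.closedBall_subset_closedBall (by linarith) hx) (x - t) hy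
            (by simpa [dist_eq_norm] using htr)
          have h1 : ⟪gradient F (x - t), N (x - t)⟫_ℝ = ‖gradient F (x - t)‖ :=
            inner_unitNormal hy
          have h2 := abs_real_inner_le_norm (gradient F x - gradient F (x - t)) (N (x - t))
          have h3 := mul_le_of_le_one_right
            (norm_nonneg (gradient F x - gradient F (x - t))) (hN1 (x - t))
          have h4 := neg_abs_le ⟪gradient F x - gradient F (x - t), N (x - t)⟫_ℝ
          rw [inner_sub_left] at h2 h4
          have h5 := norm_sub_norm_le (gradient F x) (gradient F (x - t))
          linarith

end NormalField

/-! ### Exposed regions of masks with finite regularizer -/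

section Threshold

variable {α R h δ₀ : ℝ} {K J : Plane → ℂ} {f : ℝ → ℝ≥0∞} {φ : ℝ → ℝ}
  {u v : Lp ℝ 1 (volume : Measure Plane)}

/-- Finiteness of the regularizer forces the nonlocal gradient constraint. -/
theorem le_norm_gradient_sq_of_regularizer_lt_top (hf : IsPenalty α δ₀ f)
    (hφ : Continuous φ) (hI : ContDiff ℝ 1 (intensity K J u))
    (hu : regularizer K J f φ u < ∞) (x : Plane) :
    φ (intensity K J u x) ≤ ‖gradient (intensity K J u) x‖ ^ 2 := by
  set g := fun x => ‖gradient (intensity K J u) x‖ ^ 2 - φ (intensity K J u x)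
  have hg : Continuous g := by
    have h0 := hI.continuous
    have h1 := continuous_gradient hI
    fun_prop
  have hae : ∀ᵐ x, g x ∈ Set.Ici (0 : ℝ) := by
    filter_upwards [ae_lt_top (hf.continuous.comp hg).measurable hu.ne] with y hy
    by_contra h
    exact hy.ne (hf.eq_top _ (not_le.1 h).le)
  -- A conull set is dense, and this one is closed, so the almost everywhere inequality holds
  -- everywhere.
  have hcl : IsClosed (g ⁻¹' Set.Ici 0) := isClosed_Ici.preimage hg
  have hd : Dense (g ⁻¹' Set.Ici 0) := Measure.dense_of_ae hae
  have : x ∈ g ⁻¹' Set.Ici 0 := by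
    rw [← hcl.closure_eq]
    exact hd x
  exact sub_nonneg.1 this

/-- By continuity `φ > φ h / 2` near `h`, whence `m = √(φ h / 2)`. The bound `t < h` keeps the whole
band of levels positive. -/
theorem exists_gradient_lower_bound (hh : 0 < h) (hK : ContDiff ℝ 1 K) (hJ : Continuous J)
    (hf : IsPenalty α δ₀ f) (hφ : IsLevelWeight h δ₀ φ) :
    ∃ t > 0, t < h ∧ ∃ m > 0, ∀ u ∈ admissible R, regularizer K J f φ u < ∞ →
      ∀ x, |intensity K J u x - h| ≤ t → m ≤ ‖gradient (intensity K J u) x‖ := by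
  have hc := hφ.contDiff.continuous
  obtain ⟨s, hs, hsφ⟩ := Metric.eventually_nhds_iff.1
    (hc.continuousAt.eventually_const_lt (half_lt_self hφ.pos))
  refine ⟨min (s / 2) (h / 2), by positivity, (min_le_right _ _).trans_lt (half_lt_self hh),
    √(φ h / 2), Real.sqrt_pos.2 (half_pos hφ.pos), fun u hu hRu x hx => ?_⟩
  have h1 := le_norm_gradient_sq_of_regularizer_lt_top hf hc (contDiff_intensity hK hJ hu) hRu x
  refine (Real.sqrt_le_left (norm_nonneg _)).2 (le_trans (le_of_lt (hsφ ?_)) h1)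
  rw [Real.dist_eq]
  exact hx.trans_lt ((min_le_left _ _).trans_lt (half_lt_self hs))

theorem exists_measureReal_strip_le (hh : 0 < h) (hK : ContDiff ℝ 1 K) (hJ : Continuous J)
    (hK0 : Tendsto K (cocompact Plane) (𝓝 0)) (hf : IsPenalty α δ₀ f)
    (hφ : IsLevelWeight h δ₀ φ) :
    ∃ κ₀ > 0, ∃ A > 0, ∀ u ∈ admissible R, regularizer K J f φ u < ∞ → ∀ κ, 0 < κ → κ ≤ κ₀ →
      volume {x | |intensity K J u x - h| ≤ κ} ≠ ∞ ∧
        volume.real {x | |intensity K J u x - h| ≤ κ} ≤ A * κ := by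
  obtain ⟨t, ht, hth, m, hm, hgrad⟩ :=
    exists_gradient_lower_bound (R := R) hh hK hJ hf hφ
  -- The strip extends below level `h`, so it is enclosed through the lower positive threshold `(h -
  -- t) / 2`.
  obtain ⟨ρ, -, hρ⟩ := exists_exposed_subset_ball hK hJ hK0 R (half_pos (sub_pos.2 hth))
  -- Mollification loses twice `m / 4`, leaving a crossing speed of `m / 2`.
  obtain ⟨r, hr, hrδ⟩ := gradient_intensity_equicontinuous hK hJ R (ρ + 2)
    (show 0 < m / 4 by positivity)
  have hr' : 0 < min r 1 := lt_min hr one_pos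
  obtain ⟨L, hL, hcal⟩ := exists_calibrating_field ρ hr'
  set D := Metric.ball (0 : Plane) (ρ + 4 * min r 1)
  refine ⟨t / 2, by positivity, 4 * L * volume.real D / (m / 2) + 1, by positivity,
    fun u hu hRu κ hκ hκt => ?_⟩
  have hI := contDiff_intensity hK hJ hu
  have hsub : Metric.closedBall (0 : Plane) (ρ + 2 * min r 1) ⊆ Metric.closedBall 0 (ρ + 2) :=
    Metric.closedBall_subset_closedBall (by linarith [min_le_right r 1])
  obtain ⟨X, hX, hXL, hXn⟩ := hcal (intensity K J u) (m / 4) hI fun x hx y hy hxy =>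
    hrδ u hu x (hsub hx) y (hsub hy) (hxy.trans_le (min_le_left _ _))
  obtain ⟨hfin, hle⟩ := measureReal_strip_le hκ (half_pos hm) hI hX measure_ball_lt_top.ne hXL
    fun x hx => by
      have hxt : |intensity K J u x - h| ≤ t := hx.trans (by linarith)
      have hxρ : x ∈ Metric.ball (0 : Plane) ρ := hρ u hu (by
        rw [exposed, Set.mem_ofPred_eq]
        linarith [(abs_le.1 hxt).1])
      linarith [hXn x (Metric.ball_subset_closedBall hxρ), hgrad u hu hRu x hxt]
  refine ⟨hfin, hle.trans ?_⟩
  have : 4 * κ * L * volume.real D / (m / 2) = 4 * L * volume.real D / (m / 2) * κ := by ring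
  rw [this]
  nlinarith

/-- A field nearly calibrating the boundary of the exposed region of `u` does so for all nearby
masks, with uniformly bounded divergence. -/
theorem exists_common_calibration {R₁ : ℝ} (hh : 0 < h) (hK : ContDiff ℝ 1 K)
    (hJ : Continuous J) (hf : IsPenalty α δ₀ f) (hφ : IsLevelWeight h δ₀ φ)
    (hR₁ : Encloses R K J h f φ R₁) {θ : ℝ} (hθ : 0 < θ) (hθ1 : θ ≤ 1 / 2) :
    ∃ L, 0 ≤ L ∧ ∃ η > 0, ∀ u ∈ admissible R, regularizer K J f φ u < ∞ →
      ∃ X, IsTestField (Metric.ball (0 : Plane) (R₁ + 1)) X ∧ (∀ x, |divergence X x| ≤ L) ∧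
        ∀ v ∈ admissible R, regularizer K J f φ v < ∞ → ‖u - v‖ < η →
          variation (Metric.ball 0 (R₁ + 1)) (threshold K J h v) ≤
            ENNReal.ofReal ((1 + 2 * θ) * ∫ x in exposed K J h v, divergence X x) := by
  obtain ⟨t, ht, -, m, hm, hgrad⟩ := exists_gradient_lower_bound (R := R) hh hK hJ hf hφ
  -- The loss is `4δ = θ m ≤ θ ‖∇I(v)‖`: `2δ` from mollification, `δ` from replacing the norm of
  -- `∇I(u)` by that of `∇I(v)`, and `δ` from doing so in the pairing with `X`.
  set δ := θ * m / 4
  have hδ : 0 < δ := by positivity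
  obtain ⟨r, hr, hrδ⟩ := gradient_intensity_equicontinuous hK hJ R (R₁ + 1) hδ
  -- Scale at most `1 / 4` keeps the support of `X` inside the collar of width `1`.
  have hr' : 0 < min r (1 / 4) := lt_min hr (by norm_num)
  have hr4 := min_le_right r (1 / 4)
  obtain ⟨L, hL, hcal⟩ := exists_calibrating_field R₁ hr'
  obtain ⟨M, hM, hlip⟩ := intensity_lipschitz hK hJ R R₁
  refine ⟨L, hL, δ / M, by positivity, fun u hu hRu => ?_⟩
  have hsub : Metric.closedBall (0 : Plane) (R₁ + 2 * min r (1 / 4)) ⊆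
      Metric.closedBall 0 (R₁ + 1) := Metric.closedBall_subset_closedBall (by linarith)
  obtain ⟨X, hX, hXL, hXn⟩ := hcal (intensity K J u) δ (contDiff_intensity hK hJ hu)
    fun x hx y hy hxy => hrδ u hu x (hsub hx) y (hsub hy) (hxy.trans_le (min_le_left _ _))
  refine ⟨X, ⟨hX.contDiff, hX.compact_support, hX.support_subset.trans
    (Metric.ball_subset_ball (by linarith)), hX.norm_le_one⟩, hXL, fun v hv hRv huv => ?_⟩
  refine variation_superlevel_le ht (contDiff_intensity hK hJ hv) hX.contDiff hX.compact_support
    fun x h1 h2 => ?_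
  have hx : x ∈ Metric.closedBall (0 : Plane) R₁ := Metric.ball_subset_closedBall (hR₁ v hv hRv h1)
  have hgv := hgrad v hv hRv x (by rw [abs_le]; constructor <;> linarith)
  have hduv : ‖gradient (intensity K J u) x - gradient (intensity K J v) x‖ ≤ δ := by
    refine (hlip u hu v hv x hx).2.trans ?_
    rw [lt_div_iff₀ hM] at huv
    linarith
  have hcu := hXn x hx
  have h3 := norm_sub_norm_le (gradient (intensity K J v) x) (gradient (intensity K J u) x)
  rw [norm_sub_rev] at h3
  have h4 := abs_real_inner_le_norm
    (gradient (intensity K J u) x - gradient (intensity K J v) x) (X x)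
  have h5 := mul_le_of_le_one_right
    (norm_nonneg (gradient (intensity K J u) x - gradient (intensity K J v) x)) (hX.norm_le_one x)
  have h6 := neg_abs_le ⟪gradient (intensity K J u) x - gradient (intensity K J v) x, X x⟫_ℝ
  rw [inner_sub_left] at h4 h6
  set q := ‖gradient (intensity K J v) x‖
  set i := ⟪gradient (intensity K J v) x, X x⟫_ℝ
  have h7 : q - θ * m ≤ -i := by
    have : 4 * δ = θ * m := by ring
    linarith
  have h8 : (1 - θ) * q ≤ -i := by nlinarith
  have hq : 0 ≤ q := norm_nonneg _
  -- `(1 + 2θ)(1 - θ) = 1 + θ(1 - 2θ) ≥ 1` since `θ ≤ 1/2`.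
  calc q ≤ (1 + 2 * θ) * ((1 - θ) * q) := by
        have : 0 ≤ θ * (1 - 2 * θ) * q := by
          have : 0 ≤ 1 - 2 * θ := by linarith
          positivity
        nlinarith
    _ ≤ (1 + 2 * θ) * -i := by gcongr

theorem measurableSet_exposed (hK : ContDiff ℝ 1 K) (hJ : Continuous J)
    (hu : u ∈ admissible R) : MeasurableSet (exposed K J h u) :=
  measurableSet_lt measurable_const (contDiff_intensity hK hJ hu).continuous.measurable

/-- The perimeters of exposed regions are uniformly bounded. -/
theorem exists_variation_threshold_le {R₁ : ℝ} (hh : 0 < h) (hK : ContDiff ℝ 1 K)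
    (hJ : Continuous J) (hf : IsPenalty α δ₀ f) (hφ : IsLevelWeight h δ₀ φ)
    (hR₁ : Encloses R K J h f φ R₁) :
    ∃ V : ℝ, 0 ≤ V ∧ ∀ u ∈ admissible R, regularizer K J f φ u < ∞ →
      variation (Metric.ball 0 (R₁ + 1)) (threshold K J h u) ≤ ENNReal.ofReal V := by
  obtain ⟨L, hL, η, hη, hcal⟩ :=
    exists_common_calibration hh hK hJ hf hφ hR₁ one_half_pos le_rfl
  refine ⟨2 * (L * volume.real (Metric.ball (0 : Plane) (R₁ + 1))), by positivity,
    fun u hu hRu => ?_⟩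
  obtain ⟨X, hX, hXL, hXv⟩ := hcal u hu hRu
  refine (hXv u hu hRu (by simpa using hη)).trans (ENNReal.ofReal_le_ofReal ?_)
  have := (le_abs_self _).trans (abs_setIntegral_divergence_le measure_ball_lt_top.ne
    hX.support_subset (measurableSet_exposed (h := h) hK hJ hu) hXL)
  linarith

/-- A bounded divergence turns `L¹` closeness of the sets into closeness of the fluxes. -/
theorem setIntegral_divergence_sub_le {D Ω Ω' : Set Plane} (hDv : volume D ≠ ∞)
    (hΩ : MeasurableSet Ω) (hΩ' : MeasurableSet Ω') {X : Plane → Plane} (hX : IsTestField D X)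
    {L : ℝ} (hL : ∀ x, |divergence X x| ≤ L) :
    (∫ x in Ω, divergence X x) - ∫ x in Ω', divergence X x ≤
      L * ∫ x in D, |Ω.indicator (1 : Plane → ℝ) x - Ω'.indicator 1 x| := by
  have hd := integrable_divergence hX.contDiff hX.compact_support
  have hi : ∀ S : Set Plane, MeasurableSet S →
      IntegrableOn (fun x => S.indicator (1 : Plane → ℝ) x * divergence X x) D := fun S hS => by
    have : (fun x => S.indicator (1 : Plane → ℝ) x * divergence X x) =
        S.indicator (divergence X) := by
      ext x
      by_cases hx : x ∈ S <;> simp [hx]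
    rw [this]
    exact (hd.indicator hS).integrableOn
  have h1 : ∀ S : Set Plane, MeasurableSet S → IntegrableOn (S.indicator (1 : Plane → ℝ)) D :=
    fun S hS => (integrableOn_const (C := (1 : ℝ)) hDv).indicator hS
  rw [← setIntegral_indicator_mul_divergence hΩ hX.support_subset,
    ← setIntegral_indicator_mul_divergence hΩ' hX.support_subset,
    ← integral_sub (hi Ω hΩ) (hi Ω' hΩ'), ← integral_const_mul]
  refine integral_mono ((hi Ω hΩ).sub (hi Ω' hΩ')) (((h1 Ω hΩ).sub (h1 Ω' hΩ')).abs.const_mul L)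
    fun x => ?_
  rw [← sub_mul, mul_comm L]
  refine (le_abs_self _).trans ?_
  rw [abs_mul]
  exact mul_le_mul_of_nonneg_left (hL x) (abs_nonneg _)

/-- Exposed regions of nearby masks differ by a set of small area. -/
theorem exists_integral_threshold_sub_le {R₁ : ℝ} (hh : 0 < h) (hK : ContDiff ℝ 1 K)
    (hJ : Continuous J) (hK0 : Tendsto K (cocompact Plane) (𝓝 0)) (hf : IsPenalty α δ₀ f)
    (hφ : IsLevelWeight h δ₀ φ) (hR₁ : Encloses R K J h f φ R₁) {ε : ℝ} (hε : 0 < ε) :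
    ∃ η > 0, ∀ u ∈ admissible R, regularizer K J f φ u < ∞ →
      ∀ v ∈ admissible R, regularizer K J f φ v < ∞ → ‖u - v‖ < η →
        ∫ x in Metric.ball (0 : Plane) (R₁ + 1), |threshold K J h u x - threshold K J h v x| ≤
          ε := by
  obtain ⟨κ₀, hκ₀, A, hA, hstrip⟩ :=
    exists_measureReal_strip_le (R := R) hh hK hJ hK0 hf hφ
  obtain ⟨M, hM, hlip⟩ := intensity_lipschitz hK hJ R R₁
  set κ := min κ₀ (ε / A)
  have hκ : 0 < κ := lt_min hκ₀ (by positivity)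
  refine ⟨κ / M, by positivity, fun u hu hRu v hv hRv huv => ?_⟩
  obtain ⟨hfin, hle⟩ := hstrip u hu hRu κ hκ (min_le_left _ _)
  set S := {x | |intensity K J u x - h| ≤ κ}
  have hcI := (contDiff_intensity hK hJ hu).continuous
  have hSm : MeasurableSet S := (isClosed_le (by fun_prop) continuous_const).measurableSet
  have hSi : Integrable (S.indicator (1 : Plane → ℝ)) :=
    (integrableOn_const (C := (1 : ℝ)) hfin).integrable_indicator hSm
  have hpt : ∀ x, |threshold K J h u x - threshold K J h v x| ≤
      S.indicator (1 : Plane → ℝ) x := fun x => by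
    have hclose : x ∈ Metric.ball (0 : Plane) R₁ →
        |intensity K J u x - intensity K J v x| ≤ κ := fun hx => by
      refine (hlip u hu v hv x (Metric.ball_subset_closedBall hx)).1.trans ?_
      rw [lt_div_iff₀ hM] at huv
      linarith
    have hnonneg : 0 ≤ S.indicator (1 : Plane → ℝ) x :=
      Set.indicator_nonneg (fun _ _ => zero_le_one) x
    unfold threshold
    by_cases hxu : x ∈ exposed K J h u <;> by_cases hxv : x ∈ exposed K J h v
    · simpa [hxu, hxv] using hnonneg
    -- Here `h` separates two intensities at distance at most `κ`, so `x` lies in the strip of `u`;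
    -- `hR₁` puts `x` in the ball where the Lipschitz bound holds.
    · have h1 : h < intensity K J u x := hxu
      have h2 : intensity K J v x ≤ h := not_lt.1 hxv
      obtain ⟨h3, h4⟩ := abs_le.1 (hclose (hR₁ u hu hRu hxu))
      have hxS : x ∈ S := show |intensity K J u x - h| ≤ κ from
        abs_le.2 ⟨by linarith, by linarith⟩
      simp [hxu, hxv, hxS]
    · have h1 : h < intensity K J v x := hxv
      have h2 : intensity K J u x ≤ h := not_lt.1 hxu
      obtain ⟨h3, h4⟩ := abs_le.1 (hclose (hR₁ v hv hRv hxv))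
      have hxS : x ∈ S := show |intensity K J u x - h| ≤ κ from
        abs_le.2 ⟨by linarith, by linarith⟩
      simp [hxu, hxv, hxS]
    · simpa [hxu, hxv] using hnonneg
  calc ∫ x in Metric.ball (0 : Plane) (R₁ + 1), |threshold K J h u x - threshold K J h v x|
      ≤ ∫ x in Metric.ball (0 : Plane) (R₁ + 1), S.indicator (1 : Plane → ℝ) x :=
        integral_mono_of_nonneg (Eventually.of_forall fun _ => abs_nonneg _) hSi.integrableOn
          (Eventually.of_forall hpt)
    _ ≤ ∫ x, S.indicator (1 : Plane → ℝ) x :=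
        setIntegral_le_integral hSi (Eventually.of_forall fun x =>
          Set.indicator_nonneg (fun _ _ => zero_le_one) x)
    _ = volume.real S := integral_indicator_one hSm
    _ ≤ A * κ := hle
    _ ≤ A * (ε / A) := by gcongr; exact min_le_right _ _
    _ = ε := by field_simp

/-- One-sided uniform continuity of the perimeter of the exposed region. -/
theorem exists_variation_sub_le {R₁ : ℝ} (hh : 0 < h) (hK : ContDiff ℝ 1 K)
    (hJ : Continuous J) (hK0 : Tendsto K (cocompact Plane) (𝓝 0)) (hf : IsPenalty α δ₀ f)
    (hφ : IsLevelWeight h δ₀ φ) (hR₁ : Encloses R K J h f φ R₁) {ε : ℝ} (hε : 0 < ε) :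
    ∃ η > 0, ∀ u ∈ admissible R, regularizer K J f φ u < ∞ →
      ∀ v ∈ admissible R, regularizer K J f φ v < ∞ → ‖u - v‖ < η →
        (variation (Metric.ball 0 (R₁ + 1)) (threshold K J h v)).toReal -
          (variation (Metric.ball 0 (R₁ + 1)) (threshold K J h u)).toReal ≤ ε := by
  obtain ⟨V, hV, hVu⟩ := exists_variation_threshold_le hh hK hJ hf hφ hR₁
  -- Error budget: `2θ P(u) ≤ ε / 2` from the calibration factor, and `(1 + 2θ) ε / 4 ≤ ε / 2` from
  -- the change of flux.
  set θ := min (1 / 2) (ε / (4 * (V + 1)))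
  have hθ : 0 < θ := lt_min one_half_pos (by positivity)
  have hθ1 : θ ≤ 1 / 2 := min_le_left _ _
  have hθ2 : 2 * θ * V ≤ ε / 2 := by
    calc 2 * θ * V ≤ 2 * (ε / (4 * (V + 1))) * (V + 1) := by
          gcongr
          · exact min_le_right _ _
          · linarith
      _ = ε / 2 := by field_simp; norm_num
  obtain ⟨L, hL, η₁, hη₁, hcal⟩ := exists_common_calibration hh hK hJ hf hφ hR₁ hθ hθ1
  obtain ⟨η₂, hη₂, hL1⟩ := exists_integral_threshold_sub_le hh hK hJ hK0 hf hφ hR₁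
    (show 0 < ε / (4 * (L + 1)) by positivity)
  refine ⟨min η₁ η₂, lt_min hη₁ hη₂, fun u hu hRu v hv hRv huv => ?_⟩
  obtain ⟨X, hX, hXL, hXv⟩ := hcal u hu hRu
  set D := Metric.ball (0 : Plane) (R₁ + 1)
  have hmu := measurableSet_exposed (h := h) hK hJ hu
  have hmv := measurableSet_exposed (h := h) hK hJ hv
  have h1 := hXv v hv hRv (huv.trans_le (min_le_left _ _))
  have h2 := setIntegral_divergence_sub_le measure_ball_lt_top.ne hmv hmu hX hXL
  have h3 := hL1 u hu hRu v hv hRv (huv.trans_le (min_le_right _ _))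
  have hfin := (hVu u hu hRu).trans_lt ENNReal.ofReal_lt_top
  have hPV : (variation D (threshold K J h u)).toReal ≤ V :=
    ENNReal.toReal_le_of_le_ofReal hV (hVu u hu hRu)
  have hPu : ∫ x in exposed K J h u, divergence X x ≤
      (variation D (threshold K J h u)).toReal :=
    (ENNReal.ofReal_le_iff_le_toReal hfin.ne).1
      (ofReal_setIntegral_divergence_le_variation hmu hX)
  have hP0 : 0 ≤ (variation D (threshold K J h u)).toReal := ENNReal.toReal_nonneg
  have h4 : L * ∫ x in D, |(exposed K J h v).indicator (1 : Plane → ℝ) x -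
      (exposed K J h u).indicator 1 x| ≤ ε / 4 := by
    simp_rw [abs_sub_comm ((exposed K J h v).indicator (1 : Plane → ℝ) _)]
    calc _ ≤ (L + 1) * (ε / (4 * (L + 1))) :=
          mul_le_mul (by linarith) h3 (integral_nonneg fun _ => abs_nonneg _) (by linarith)
      _ = ε / 4 := by field_simp
  set P := (variation D (threshold K J h u)).toReal
  have h5 : (1 + 2 * θ) * ∫ x in exposed K J h v, divergence X x ≤ P + ε := by
    calc (1 + 2 * θ) * ∫ x in exposed K J h v, divergence X x
        ≤ (1 + 2 * θ) * (P + ε / 4) := by gcongr; linarith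
      _ = P + 2 * θ * P + (1 + 2 * θ) * (ε / 4) := by ring
      _ ≤ P + 2 * θ * V + 2 * (ε / 4) := by gcongr; linarith
      _ ≤ P + ε := by linarith
  have h6 := ENNReal.toReal_le_of_le_ofReal (by linarith)
    (h1.trans (ENNReal.ofReal_le_ofReal h5))
  linarith

end Threshold

end Lithography

/-! ### Strict continuity of the thresholding map -/

theorem lemma3p5
    (α R h δ₀ a : ℝ) (hα : 0 < α) (hα1 : α ≤ 1) (hR : 0 < R) (hh : 0 < h) (hδ₀ : 0 < δ₀)
    (ha : 0 < a)
    (K : Lithography.Plane → ℂ) (hK : Lithography.IsC1Holder α K)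
    (hK0 : Tendsto K (cocompact Lithography.Plane) (𝓝 0))
    (J : Lithography.Plane → ℂ) (Jhat : Lithography.Plane → ℝ) (hJhat : Integrable Jhat)
    (hJhat0 : ∀ᵐ ξ, 0 ≤ Jhat ξ) (hJ : ∀ x, J x = Lithography.fourier Jhat x)
    (f : ℝ → ℝ≥0∞) (hf : Lithography.IsPenalty α δ₀ f)
    (φ : ℝ → ℝ) (hφ : Lithography.IsLevelWeight h δ₀ φ) :
    (∃ R₁ : ℝ, R ≤ R₁ ∧ Lithography.Encloses R K J h f φ R₁) ∧
    ∀ R₁ : ℝ, R ≤ R₁ → Lithography.Encloses R K J h f φ R₁ →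
      ∀ C : ℝ, 0 < C →
        (∀ u ∈ Lithography.sublevel R K J f φ C,
          Lithography.MemBV (Metric.ball 0 (R₁ + 1)) (Lithography.threshold K J h u)) ∧
        ∀ ε : ℝ, 0 < ε → ∃ η : ℝ, 0 < η ∧
          ∀ u ∈ Lithography.sublevel R K J f φ C, ∀ v ∈ Lithography.sublevel R K J f φ C,
            ‖u - v‖ < η →
              Lithography.strictDist a (Metric.ball 0 (R₁ + 1))
                (Lithography.threshold K J h u) (Lithography.threshold K J h v) < ε := by
  have hK1 := hK.1
  have hJc : Continuous J := by
    rw [show J = Lithography.fourier Jhat from funext hJ]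
    exact Lithography.continuous_fourier hJhat
  refine ⟨?_, fun R₁ _ hR₁ C _ => ⟨fun u hu => ⟨?_, ?_⟩, fun ε hε => ?_⟩⟩
  · obtain ⟨R₁, h1, h2⟩ := Lithography.exists_exposed_subset_ball hK1 hJc hK0 R hh
    exact ⟨R₁, h1, fun u hu _ => h2 u hu⟩
  · exact (integrableOn_const (C := (1 : ℝ)) measure_ball_lt_top.ne).indicator
      (Lithography.measurableSet_exposed hK1 hJc hu.1)
  · obtain ⟨V, -, hV⟩ := Lithography.exists_variation_threshold_le hh hK1 hJc hf hφ hR₁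
    exact (hV u hu.1 (hu.2.trans_lt ENNReal.ofReal_lt_top)).trans_lt ENNReal.ofReal_lt_top
  · obtain ⟨η₁, hη₁, h1⟩ := Lithography.exists_integral_threshold_sub_le hh hK1 hJc hK0 hf hφ hR₁
      (show 0 < ε / 4 by positivity)
    obtain ⟨η₂, hη₂, h2⟩ := Lithography.exists_variation_sub_le hh hK1 hJc hK0 hf hφ hR₁
      (show 0 < ε / (4 * a) by positivity)
    refine ⟨min η₁ η₂, lt_min hη₁ hη₂, fun u hu v hv huv => ?_⟩
    have hRu := hu.2.trans_lt ENNReal.ofReal_lt_top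
    have hRv := hv.2.trans_lt ENNReal.ofReal_lt_top
    have h3 := h1 u hu.1 hRu v hv.1 hRv (huv.trans_le (min_le_left _ _))
    have huv' := huv.trans_le (min_le_right _ _)
    have h4 := h2 u hu.1 hRu v hv.1 hRv huv'
    -- The one-sided bound is applied in both orders; the total is `ε / 4 + a · ε / (4a) = ε / 2 <
    -- ε`.
    have h5 := h2 v hv.1 hRv u hu.1 hRu (by rwa [norm_sub_rev])
    have h6 := mul_le_mul_of_nonneg_left (abs_sub_le_iff.2 ⟨h5, h4⟩) ha.le
    have h7 : a * (ε / (4 * a)) = ε / 4 := by field_simp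
    unfold Lithography.strictDist
    linarith
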